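/- Let $p:(0,1)\to[1,\infty)$ be nondecreasing and bounded (that is, $p(1):=\lim_{x\to1^-}p(x)<\infty$). Let $p'(x)\in(1,\infty]$ be the conjugate exponent, $\frac1{p(x)}+\frac1{p'(x)}=1$, with $p'(x)=\infty$ and $\frac{1}{p'(x)}=0$ if $p(x)=1$. For an interval $I\subseteq(0,1)$ and a measurable function $g:I\to[0,\infty]$ put $$\|g\|_{L^{p(\cdot)}(I)}=\inf\Big\{\lambda>0:\int_I\Big(\frac{g(x)}{\lambda}\Big)^{p(x)}dx\le1\Big\}\in[0,\infty]$$ (with $\inf\emptyset=\infty$), and for measurable $f:(0,1)\to[0,\infty)$ let $Hf(x)=\int_0^x f(t)\,dt\in[0,\infty]$. Then the following five statements are equivalent: 1. There is a constant $C>0$ such that $\|x^{-1}Hf\|_{L^{p(\cdot)}(0,1)}\le C\|f\|_{L^{p(\cdot)}(0,1)}$ for every measurable $f:(0,1)\to[0,\infty)$. 2. There is a constant $C>0$ such that $\displaystyle\int_a^1 x^{-1/p'(x)}\,\frac{dx}{x}\le C\,a^{-1/p'(a)}$ for all $0<a<1$. 3. There is an $\epsilon>0$ such that the function $x^{-1/p'(x)+\epsilon}$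 is almost decreasing on $(0,1)$: there is a constant $C>0$ with $t_2^{-1/p'(t_2)+\epsilon}\le C\,t_1^{-1/p'(t_1)+\epsilon}$ whenever $0<t_1\le t_2<1$. 4. There is a constant $C>0$ such that $\displaystyle\int_a^1\Big(a^{1/p'(a)}x^{-1/p'(x)}\Big)^{p(x)}\frac{dx}{x}\le C$ for all $0<a<1$. 5. There is a constant $C>0$ such that $\|x^{-1}\|_{L^{p(\cdot)}(a,1)}\le C\,a^{-1/p'(a)}$ for all $0<a<1$. -/

import Mathlib

open Set MeasureTheory
open scoped ENNReal

/-- The modular `I_{p(·)}(g) = ∫_s g(x)^{p(x)} dx` of a function `g ≥ 0` on `s ⊆ ℝ`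
(Lebesgue measure, values in `[0, ∞]`). -/
noncomputable def varModular (p : ℝ → ℝ) (s : Set ℝ) (g : ℝ → ℝ≥0∞) : ℝ≥0∞ :=
  ∫⁻ x in s, g x ^ p x

/-- The Luxemburg norm `‖g‖_{L^{p(·)}(s)} = inf {l > 0 : I_{p(·)}(g / l) ≤ 1}` of a function
`g ≥ 0`; it is `∞` when no real number `l > 0` is admissible. -/
noncomputable def varNorm (p : ℝ → ℝ) (s : Set ℝ) (g : ℝ → ℝ≥0∞) : ℝ≥0∞ :=
  sInf {l : ℝ≥0∞ | 0 < l ∧ l < ∞ ∧ varModular p s (fun x => g x / l) ≤ 1}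

/-- Hardy's operator `Hf(x) = ∫_0^x f(t) dt` for a function `f ≥ 0`, with values in `[0, ∞]`. -/
noncomputable def hardyOp (f : ℝ → ℝ≥0∞) (x : ℝ) : ℝ≥0∞ :=
  ∫⁻ t in Ioo 0 x, f t

/-- The conjugate exponent `p'(x) ∈ [1, ∞]`, `1 / p(x) + 1 / p'(x) = 1`, with `p'(x) = ∞`
where `p(x) = 1`. -/
noncomputable def conjExp (p : ℝ → ℝ) (x : ℝ) : ℝ≥0∞ :=
  (ENNReal.ofReal (p x)).conjExponent

/-- The real number `1 / p'(x)`, which is `0` where `p'(x) = ∞`. -/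
noncomputable def invConj (p : ℝ → ℝ) (x : ℝ) : ℝ :=
  ((conjExp p x)⁻¹).toReal

theorem invConj_eq {p : ℝ → ℝ} {x : ℝ} (hx : 1 ≤ p x) : invConj p x = 1 - 1 / p x := by
  have h1 : (1 : ℝ≥0∞) ≤ ENNReal.ofReal (p x) := by simpa using hx
  have h := (ENNReal.HolderConjugate.conjExponent h1).inv_add_inv_eq_one
  have hp : (ENNReal.ofReal (p x))⁻¹ ≠ ∞ := by
    simpa using lt_of_lt_of_le one_pos hx
  have hq : ((ENNReal.ofReal (p x)).conjExponent)⁻¹ ≠ ∞ := by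
    intro hq
    rw [hq] at h
    simp at h
  have h2 := congrArg ENNReal.toReal h
  rw [ENNReal.toReal_add hp hq, ENNReal.toReal_inv (ENNReal.ofReal (p x)),
    ENNReal.toReal_ofReal (zero_le_one.trans hx), ENNReal.toReal_one] at h2
  rw [invConj, conjExp, one_div]
  linarith

/-- `f` is almost decreasing on `s`: `f(y) ≤ C f(x)` for all `x ≤ y` in `s`, for some
constant `C > 0`. -/
def AlmostDecreasingOn (f : ℝ → ℝ) (s : Set ℝ) : Prop :=
  ∃ C : ℝ, 0 < C ∧ ∀ x ∈ s, ∀ y ∈ s, x ≤ y → f y ≤ C * f x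

/-!
Write `q = 1 / p'` and `w x = x ^ (-q x)`. Everything is compared with the third statement, which
says that `w y ≤ C * w x * (x / y) ^ ε` for `x ≤ y`: the weight grows at least like a power towards
the origin (`almostDecreasingOn_rpow_iff`).

* Inserting this bound into the integrals of the second and fourth statements leaves
  `∫ (a / x) ^ ε dx / x`, which is at most `1 / ε`.
* Conversely (`exists_almostDecreasingOn_of_lintegral_le`), suppose that
  `F a = ∫_a^1 w ^ m dx / x ≤ C * w a ^ m`. Since `w ≥ 1`, the function `G = 1 + F` satisfies
  `G ≤ (C + 1) * w ^ m`, so that halving `a` multiplies `G` by a fixed factor `θ > 1`. As `q` is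
  nondecreasing and at most `1`, doubling the argument loses at most half of the weight, and so
  `w ^ m` is bounded by a multiple of `G`. Hence `w ^ m` inherits the power growth of `G`.
  The second statement is the case `m = 1`. The fourth one first yields that `w` is almost
  decreasing, which allows replacing the exponent `p x` by an upper bound `m = P` of `p`.
* The identity `x ^ (-q x * p x) / x = x⁻¹ ^ p x` turns the fourth statement into a bound on the
  modular of `x⁻¹ / w a`, which is the fifth statement because `p` is bounded.
* Hardy's inequality gives the fifth statement by testing with `a ^ (-1 / p a)` on `(0, a)`, whose
  norm is at most one because `p ≤ p a` there.
* For Hardy's inequality (`exists_varModular_hardy_le`), put `g t = t ^ (1 / p t) * f t`, so that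
  the modular of `f` is `∫ g t ^ p t dt / t`. The third statement gives
  `w x * Hf x ≤ C * ∫_0^x (t / x) ^ ε * g t dt / t`. The part where `g ≤ 1` is treated by Jensen's
  inequality with exponent `p x`, and there `g t ^ p x ≤ g t ^ p t` because `p t ≤ p x`. Where
  `g ≥ 1`, one has `g t ≤ g t ^ p t`, so the integral over that part is at most one and raising it
  to the power `p x` makes it smaller (`rpow_lintegral_kernel_le`). Tonelli's theorem concludes
  (`lintegral_lintegral_kernel_le`).
-/

/-! ### Growth of power weights -/

theorem almostDecreasingOn_rpow_iff {q : ℝ → ℝ} {ε : ℝ} :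
    AlmostDecreasingOn (fun x => x ^ (-q x + ε)) (Ioo 0 1) ↔
      ∃ C : ℝ, 0 < C ∧ ∀ x ∈ Ioo (0 : ℝ) 1, ∀ y ∈ Ioo (0 : ℝ) 1, x ≤ y →
        y ^ (-q y) ≤ C * x ^ (-q x) * (x / y) ^ ε := by
  refine exists_congr fun C => and_congr_right fun _ => forall₂_congr fun x hx =>
    forall₂_congr fun y hy => imp_congr_right fun _ => ?_
  beta_reduce
  rw [Real.rpow_add hx.1, Real.rpow_add hy.1, Real.div_rpow hx.1.le hy.1.le, ← mul_div_assoc,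
    le_div_iff₀ (Real.rpow_pos_of_pos hy.1 ε), mul_assoc]

theorem one_le_rpow_neg {x s : ℝ} (hx : x ∈ Ioo (0 : ℝ) 1) (hs : 0 ≤ s) : 1 ≤ x ^ (-s) :=
  Real.one_le_rpow_of_pos_of_le_one_of_nonpos hx.1 hx.2.le (by linarith)

/-- If `q ≤ 1` is nondecreasing, then the weight `x ^ (-q x)` loses at most a factor two from `u` to
`2 * u`. -/
theorem rpow_neg_le_two_mul {q : ℝ → ℝ} (hq1 : ∀ x ∈ Ioo (0 : ℝ) 1, q x ≤ 1)
    (hqm : MonotoneOn q (Ioo 0 1)) {u x : ℝ} (hu : u ∈ Ioo (0 : ℝ) 1) (hx : x ∈ Ioo (0 : ℝ) 1)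
    (hux : u ≤ x) (hx2 : x ≤ 2 * u) (hq0 : 0 ≤ q u) :
    u ^ (-q u) ≤ 2 * x ^ (-q x) := by
  have h1 : x ^ (-q u) ≤ x ^ (-q x) :=
    Real.rpow_le_rpow_of_exponent_ge hx.1 hx.2.le (neg_le_neg (hqm hu hx hux))
  have h2 : (2 * u) ^ (-q u) ≤ x ^ (-q u) :=
    Real.rpow_le_rpow_of_nonpos hx.1 hx2 (by linarith)
  have h3 : (2 : ℝ) ^ (-1 : ℝ) ≤ 2 ^ (-q u) :=
    Real.rpow_le_rpow_of_exponent_le one_le_two (by linarith [hq1 u hu])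
  rw [Real.mul_rpow zero_le_two hu.1.le] at h2
  rw [Real.rpow_neg_one] at h3
  have h4 := Real.rpow_pos_of_pos hu.1 (-q u)
  nlinarith

theorem rpow_neg_le_two {x s : ℝ} (hx : x ∈ Ioo (0 : ℝ) 1) (hx2 : 1 / 2 ≤ x) (hs : s ≤ 1) :
    x ^ (-s) ≤ 2 := by
  calc x ^ (-s) ≤ x ^ (-1 : ℝ) :=
        Real.rpow_le_rpow_of_exponent_ge hx.1 hx.2.le (by linarith)
    _ = x⁻¹ := Real.rpow_neg_one x
    _ ≤ (1 / 2)⁻¹ := inv_anti₀ (by norm_num) hx2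
    _ = 2 := by norm_num

theorem ofReal_mul_sub_le_lintegral {a b c : ℝ} (hc : 0 ≤ c) {f : ℝ → ℝ}
    (hf : ∀ x ∈ Ioo a b, c ≤ f x) :
    ENNReal.ofReal (c * (b - a)) ≤ ∫⁻ x in Ioo a b, ENNReal.ofReal (f x) := by
  calc ENNReal.ofReal (c * (b - a)) = ∫⁻ _ in Ioo a b, ENNReal.ofReal c := by
        rw [setLIntegral_const, Real.volume_Ioo, ENNReal.ofReal_mul hc]
    _ ≤ _ := setLIntegral_mono' measurableSet_Ioo fun x hx => ENNReal.ofReal_le_ofReal (hf x hx)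

theorem lintegral_Ioo_div_rpow_le {a ε : ℝ} (ha : 0 < a) (hε : 0 < ε) :
    ∫⁻ x in Ioo a 1, ENNReal.ofReal ((a / x) ^ ε / x) ≤ ENNReal.ofReal (1 / ε) := by
  have hint : IntegrableOn (fun x : ℝ => a ^ ε * x ^ (-ε - 1)) (Ioi a) :=
    (integrableOn_Ioi_rpow_of_lt (by linarith) ha).const_mul _
  calc ∫⁻ x in Ioo a 1, ENNReal.ofReal ((a / x) ^ ε / x)
      ≤ ∫⁻ x in Ioi a, ENNReal.ofReal ((a / x) ^ ε / x) := lintegral_mono_set Ioo_subset_Ioi_self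
    _ = ∫⁻ x in Ioi a, ENNReal.ofReal (a ^ ε * x ^ (-ε - 1)) := by
        refine setLIntegral_congr_fun measurableSet_Ioi fun x hx => ?_
        have hx0 : 0 < x := ha.trans hx
        rw [Real.div_rpow ha.le hx0.le, Real.rpow_sub_one hx0.ne', Real.rpow_neg hx0.le]
        congr 1
        field_simp
    _ = ENNReal.ofReal (∫ x in Ioi a, a ^ ε * x ^ (-ε - 1)) := by
        rw [ofReal_integral_eq_lintegral_ofReal hint]
        filter_upwards [ae_restrict_mem measurableSet_Ioi] with x hx
        have hx0 : 0 < x := ha.trans hx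
        simp only [Pi.zero_apply]
        positivity
    _ = ENNReal.ofReal (1 / ε) := by
        rw [integral_const_mul, integral_Ioi_rpow_of_lt (by linarith) ha]
        congr 1
        have := Real.rpow_pos_of_pos ha ε
        rw [show -ε - 1 + 1 = -ε by ring, Real.rpow_neg ha.le]
        field_simp

theorem lintegral_Ioo_zero_div_rpow_le {x ε : ℝ} (hx : 0 < x) (hε : 0 < ε) :
    ∫⁻ t in Ioo 0 x, ENNReal.ofReal ((t / x) ^ ε / t) ≤ ENNReal.ofReal (1 / ε) := by
  have hint : IntervalIntegrable (fun t : ℝ => (x ^ ε)⁻¹ * t ^ (ε - 1)) volume 0 x :=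
    (intervalIntegral.intervalIntegrable_rpow' (by linarith)).const_mul _
  calc ∫⁻ t in Ioo 0 x, ENNReal.ofReal ((t / x) ^ ε / t)
      = ∫⁻ t in Ioo 0 x, ENNReal.ofReal ((x ^ ε)⁻¹ * t ^ (ε - 1)) := by
        refine setLIntegral_congr_fun measurableSet_Ioo fun t ht => ?_
        rw [Real.div_rpow ht.1.le hx.le, Real.rpow_sub_one ht.1.ne']
        congr 1
        field_simp
    _ ≤ ∫⁻ t in Ioc 0 x, ENNReal.ofReal ((x ^ ε)⁻¹ * t ^ (ε - 1)) :=
        lintegral_mono_set Ioo_subset_Ioc_self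
    _ = ENNReal.ofReal (∫ t in (0)..x, (x ^ ε)⁻¹ * t ^ (ε - 1)) := by
        rw [intervalIntegral.integral_of_le hx.le, ofReal_integral_eq_lintegral_ofReal hint.1]
        filter_upwards [ae_restrict_mem measurableSet_Ioc] with t ht
        have ht0 : 0 < t := ht.1
        simp only [Pi.zero_apply]
        positivity
    _ ≤ ENNReal.ofReal (1 / ε) := by
        rw [intervalIntegral.integral_const_mul, integral_rpow (Or.inl (by linarith)),
          sub_add_cancel, Real.zero_rpow hε.ne']
        have := Real.rpow_pos_of_pos hx ε
        apply le_of_eq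
        congr 1
        field_simp
        ring

/-- A Bari–Stechkin type lemma: if the tail integrals of the `m`-th power of the weight
`x ^ (-q x)` with respect to `dx / x` are controlled by the value at the endpoint, then the weight
grows at least like a power of `1 / x`. -/
theorem exists_almostDecreasingOn_of_lintegral_le {q : ℝ → ℝ}
    (hq0 : ∀ x ∈ Ioo (0 : ℝ) 1, 0 ≤ q x) (hq1 : ∀ x ∈ Ioo (0 : ℝ) 1, q x ≤ 1)
    (hqm : MonotoneOn q (Ioo 0 1)) {m C : ℝ} (hm : 0 < m) (hC : 0 < C)
    (h : ∀ a ∈ Ioo (0 : ℝ) 1, ∫⁻ x in Ioo a 1, ENNReal.ofReal ((x ^ (-q x)) ^ m / x)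
      ≤ ENNReal.ofReal (C * (a ^ (-q a)) ^ m)) :
    ∃ ε : ℝ, 0 < ε ∧ AlmostDecreasingOn (fun x => x ^ (-q x + ε)) (Ioo 0 1) := by
  set w : ℝ → ℝ := fun x => (x ^ (-q x)) ^ m with hw
  have hw1 : ∀ x ∈ Ioo (0 : ℝ) 1, 1 ≤ w x := fun x hx =>
    Real.one_le_rpow (one_le_rpow_neg hx (hq0 x hx)) hm.le
  set F : ℝ → ℝ≥0∞ := fun a => ∫⁻ x in Ioo a 1, ENNReal.ofReal (w x / x) with hF
  set G : ℝ → ℝ≥0∞ := fun a => 1 + F a with hG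
  have hGanti : Antitone G := fun a b hab =>
    add_le_add_right (lintegral_mono_set (Ioo_subset_Ioo_left hab)) _
  have hup : ∀ a ∈ Ioo (0 : ℝ) 1, G a ≤ ENNReal.ofReal ((C + 1) * w a) := by
    intro a ha
    have h1 := hw1 a ha
    calc G a ≤ ENNReal.ofReal (w a) + ENNReal.ofReal (C * w a) :=
          add_le_add (ENNReal.one_le_ofReal.2 h1) (h a ha)
      _ = _ := by
          rw [← ENNReal.ofReal_add (by linarith) (by positivity)]
          congr 1; ring
  have hlow : ∀ a ∈ Ioo (0 : ℝ) 1, ENNReal.ofReal (w a) ≤ ENNReal.ofReal (2 * 2 ^ m) * G a := by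
    intro a ha
    have h2m : (0 : ℝ) < 2 ^ m := by positivity
    rcases le_total (1 / 2) a with h2 | h2
    · have h3 : w a ≤ 2 ^ m := Real.rpow_le_rpow (Real.rpow_nonneg ha.1.le _)
        (rpow_neg_le_two ha h2 (hq1 a ha)) hm.le
      calc ENNReal.ofReal (w a) ≤ ENNReal.ofReal (2 * 2 ^ m) * 1 := by
            rw [mul_one]; exact ENNReal.ofReal_le_ofReal (by linarith)
        _ ≤ _ := by gcongr; exact le_self_add
    · have h3 : ENNReal.ofReal (w a / 2 ^ m / (2 * a) * (2 * a - a)) ≤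
          ∫⁻ x in Ioo a (2 * a), ENNReal.ofReal (w x / x) := by
        have hwa : 0 < w a := by linarith [hw1 a ha]
        have ha0 := ha.1
        refine ofReal_mul_sub_le_lintegral (by positivity) fun x hx => ?_
        have hx1 : x ∈ Ioo (0 : ℝ) 1 := ⟨ha.1.trans hx.1, by linarith [hx.2]⟩
        have hx0 := hx1.1
        have h4 := rpow_neg_le_two_mul hq1 hqm ha hx1 hx.1.le hx.2.le (hq0 a ha)
        have h5 : w a ≤ 2 ^ m * w x := by
          rw [hw]; simp only
          rw [← Real.mul_rpow zero_le_two (Real.rpow_nonneg hx1.1.le _)]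
          exact Real.rpow_le_rpow (Real.rpow_nonneg ha.1.le _) h4 hm.le
        have h6 : w a / 2 ^ m ≤ w x := by rw [div_le_iff₀ h2m]; linarith
        have := hw1 x hx1
        gcongr
        exact hx.2.le
      calc ENNReal.ofReal (w a)
          = ENNReal.ofReal (2 * 2 ^ m) * ENNReal.ofReal (w a / 2 ^ m / (2 * a) * (2 * a - a)) := by
            rw [← ENNReal.ofReal_mul (by positivity)]
            congr 1
            have := ha.1
            field_simp
            ring
        _ ≤ ENNReal.ofReal (2 * 2 ^ m) * G a := by
            gcongr
            exact h3.trans ((lintegral_mono_set (Ioo_subset_Ioo_right (by linarith))).trans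
              le_add_self)
  set θ : ℝ := 1 + 1 / (2 * (C + 1)) with hθ
  have hθ1 : 1 < θ := by
    have : 0 < 1 / (2 * (C + 1)) := by positivity
    linarith
  -- Each point of `(a / 2, a)` contributes at least `G a / (C + 1)` to `F (a / 2) - F a`, and
  -- `∫ dx / x ≥ 1 / 2` over this interval.
  have hdouble : ∀ a ∈ Ioo (0 : ℝ) 1, ENNReal.ofReal θ * G a ≤ G (a / 2) := by
    intro a ha
    have hfin : G a ≠ ∞ := ((hup a ha).trans_lt ENNReal.ofReal_lt_top).ne
    set g := (G a).toReal with hg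
    have hGg : G a = ENNReal.ofReal g := (ENNReal.ofReal_toReal hfin).symm
    have hg0 : 0 ≤ g := ENNReal.toReal_nonneg
    have ha0 := ha.1
    have h3 : ENNReal.ofReal (g / (C + 1) / a * (a - a / 2)) ≤
        ∫⁻ x in Ioo (a / 2) a, ENNReal.ofReal (w x / x) := by
      refine ofReal_mul_sub_le_lintegral (by positivity) fun x hx => ?_
      have hx1 : x ∈ Ioo (0 : ℝ) 1 := ⟨by linarith [hx.1, ha.1], hx.2.trans ha.2⟩
      have hx0 := hx1.1
      have h4 : g ≤ (C + 1) * w x := by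
        have := (hGanti hx.2.le).trans (hup x hx1)
        rw [hGg, ENNReal.ofReal_le_ofReal_iff (by have := hw1 x hx1; positivity)] at this
        exact this
      have h5 : g / (C + 1) ≤ w x := by rw [div_le_iff₀ (by positivity)]; linarith
      have := hw1 x hx1
      gcongr
      exact hx.2.le
    have h6 : F a + ∫⁻ x in Ioo (a / 2) a, ENNReal.ofReal (w x / x) ≤ F (a / 2) := by
      rw [hF, add_comm]
      simp only
      rw [← lintegral_union measurableSet_Ioo]
      · refine lintegral_mono_set (union_subset (Ioo_subset_Ioo_right ha.2.le)
          (Ioo_subset_Ioo_left (by linarith)))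
      · exact disjoint_left.2 fun x hx hx' => absurd hx.2 (not_lt.2 hx'.1.le)
    calc ENNReal.ofReal θ * G a
        = G a + ENNReal.ofReal (g / (C + 1) / a * (a - a / 2)) := by
          rw [hGg, ← ENNReal.ofReal_mul (by positivity), ← ENNReal.ofReal_add hg0
            (mul_nonneg (by positivity) (by linarith)), hθ]
          congr 1
          field_simp
          ring
      _ ≤ 1 + (F a + ∫⁻ x in Ioo (a / 2) a, ENNReal.ofReal (w x / x)) := by
          rw [hG]; simp only
          rw [add_assoc]
          gcongr
      _ ≤ G (a / 2) := by rw [hG]; simp only; gcongr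
  have hiter : ∀ a ∈ Ioo (0 : ℝ) 1, ∀ n : ℕ, ENNReal.ofReal (θ ^ n) * G a ≤ G (a * (1 / 2) ^ n) := by
    intro a ha n
    induction n with
    | zero => simp
    | succ n ih =>
      have ha' : a * (1 / 2) ^ n ∈ Ioo (0 : ℝ) 1 := by
        refine ⟨mul_pos ha.1 (by positivity), ?_⟩
        have : ((1 : ℝ) / 2) ^ n ≤ 1 := pow_le_one₀ (by norm_num) (by norm_num)
        nlinarith [ha.1, ha.2]
      calc ENNReal.ofReal (θ ^ (n + 1)) * G a
          = ENNReal.ofReal θ * (ENNReal.ofReal (θ ^ n) * G a) := by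
            rw [pow_succ, mul_comm (θ ^ n), ENNReal.ofReal_mul (by linarith), mul_assoc]
        _ ≤ ENNReal.ofReal θ * G (a * (1 / 2) ^ n) := by gcongr
        _ ≤ G (a * (1 / 2) ^ n / 2) := hdouble _ ha'
        _ = _ := by congr 1; ring
  -- A factor `θ` per halving is the power `δ = log₂ θ`.
  set δ : ℝ := Real.logb 2 θ with hδ
  have hδ0 : 0 < δ := Real.logb_pos one_lt_two hθ1
  have hδθ : (2 : ℝ) ^ δ = θ := Real.rpow_logb (by norm_num) (by norm_num) (by linarith)
  set D : ℝ := 2 * 2 ^ m * (C + 1) * θ with hD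
  have hD0 : 0 < D := by positivity
  refine ⟨δ / m, by positivity, almostDecreasingOn_rpow_iff.2
    ⟨D ^ (1 / m), by positivity, fun x hx y hy hxy => ?_⟩⟩
  obtain ⟨n, hn1, hn2⟩ := exists_nat_pow_near_of_lt_one (div_pos hx.1 hy.1)
    ((div_le_one hy.1).2 hxy) (one_half_pos (α := ℝ)) one_half_lt_one
  have hx0 := hx.1
  have hy0 := hy.1
  have hθn : (θ ^ n)⁻¹ ≤ θ * (x / y) ^ δ := by
    have h1 : ((1 / 2 : ℝ) ^ (n + 1)) ^ δ ≤ (x / y) ^ δ :=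
      Real.rpow_le_rpow (by positivity) hn1.le hδ0.le
    have h2 : ((1 / 2 : ℝ) ^ (n + 1)) ^ δ = (θ ^ (n + 1))⁻¹ := by
      rw [← Real.rpow_natCast, ← Real.rpow_mul (by norm_num), mul_comm, Real.rpow_mul (by norm_num),
        Real.rpow_natCast, one_div, Real.inv_rpow zero_le_two, hδθ, inv_pow]
    rw [h2] at h1
    have hθ0 : 0 < θ := by linarith
    calc (θ ^ n)⁻¹ = θ * (θ ^ (n + 1))⁻¹ := by rw [pow_succ]; field_simp
      _ ≤ _ := by gcongr
  have hmain : θ ^ n * w y ≤ 2 * 2 ^ m * ((C + 1) * w x) := by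
    have hwx := hw1 x hx
    rw [← ENNReal.ofReal_le_ofReal_iff (by positivity), ENNReal.ofReal_mul (by positivity),
      ENNReal.ofReal_mul (p := 2 * 2 ^ m) (by positivity)]
    calc ENNReal.ofReal (θ ^ n) * ENNReal.ofReal (w y)
        ≤ ENNReal.ofReal (θ ^ n) * (ENNReal.ofReal (2 * 2 ^ m) * G y) := by
          gcongr; exact hlow y hy
      _ = ENNReal.ofReal (2 * 2 ^ m) * (ENNReal.ofReal (θ ^ n) * G y) := by ring
      _ ≤ ENNReal.ofReal (2 * 2 ^ m) * G (y * (1 / 2) ^ n) := by gcongr; exact hiter y hy n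
      _ ≤ ENNReal.ofReal (2 * 2 ^ m) * G x := by
          gcongr
          apply hGanti
          rw [div_le_iff₀ hy.1] at hn2
          linarith
      _ ≤ _ := by gcongr; exact hup x hx
  have hmain2 : w y ≤ D * w x * (x / y) ^ δ := by
    have hθn0 : 0 < θ ^ n := by positivity
    have hwx := hw1 x hx
    calc w y = (θ ^ n)⁻¹ * (θ ^ n * w y) := by field_simp
      _ ≤ (θ * (x / y) ^ δ) * (2 * 2 ^ m * ((C + 1) * w x)) := by gcongr
      _ = _ := by rw [hD]; ring
  have hX : (0 : ℝ) ≤ x ^ (-q x) := Real.rpow_nonneg hx0.le _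
  have hY : (0 : ℝ) ≤ y ^ (-q y) := Real.rpow_nonneg hy0.le _
  rw [← Real.rpow_le_rpow_iff hY (by positivity) hm]
  refine hmain2.trans (le_of_eq ?_)
  have e1 : (D ^ (1 / m)) ^ m = D := by
    rw [← Real.rpow_mul hD0.le, one_div_mul_cancel hm.ne', Real.rpow_one]
  have e2 : ((x / y) ^ (δ / m)) ^ m = (x / y) ^ δ := by
    rw [← Real.rpow_mul (by positivity), div_mul_cancel₀ _ hm.ne']
  rw [Real.mul_rpow (by positivity) (by positivity), Real.mul_rpow (by positivity) hX, e1, e2]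

/-! ### The conjugate exponent, modulars and Luxemburg norms -/

theorem invConj_nonneg (p : ℝ → ℝ) (x : ℝ) : 0 ≤ invConj p x := ENNReal.toReal_nonneg

theorem invConj_le_one {p : ℝ → ℝ} {x : ℝ} (hx : 1 ≤ p x) : invConj p x ≤ 1 := by
  rw [invConj_eq hx]
  have : 0 ≤ 1 / p x := by positivity
  linarith

theorem monotoneOn_invConj {p : ℝ → ℝ} {s : Set ℝ} (hp_one : ∀ x ∈ s, 1 ≤ p x)
    (hp_mono : MonotoneOn p s) : MonotoneOn (invConj p) s := by
  intro x hx y hy hxy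
  rw [invConj_eq (hp_one x hx), invConj_eq (hp_one y hy)]
  have := one_div_le_one_div_of_le (by linarith [hp_one x hx]) (hp_mono hx hy hxy)
  linarith

theorem rpow_neg_invConj_rpow_div {p : ℝ → ℝ} {x : ℝ} (hx : 0 < x) (hp : 1 ≤ p x) :
    (x ^ (-invConj p x)) ^ p x / x = (x⁻¹) ^ p x := by
  rw [← Real.rpow_mul hx.le, invConj_eq hp, ← Real.rpow_sub_one hx.ne', Real.inv_rpow hx.le,
    ← Real.rpow_neg hx.le]
  congr 1
  field_simp
  ring

/-- The weight `x ^ (-1 / p' x)`, raised to the power `p x` and taken with the measure `dx / x`, is the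
modular density of `x⁻¹`, also after scaling by `c`. -/
theorem ofReal_mul_rpow_neg_invConj_rpow_div {p : ℝ → ℝ} {x c : ℝ} (hc : 0 < c) (hx : 0 < x)
    (hp : 1 ≤ p x) :
    ENNReal.ofReal ((c * x ^ (-invConj p x)) ^ p x / x) =
      (ENNReal.ofReal x⁻¹ / ENNReal.ofReal c⁻¹) ^ p x := by
  rw [← ENNReal.ofReal_div_of_pos (inv_pos.2 hc), ENNReal.ofReal_rpow_of_pos (by positivity),
    Real.mul_rpow hc.le (Real.rpow_nonneg hx.le _), mul_div_assoc, rpow_neg_invConj_rpow_div hx hp,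
    ← Real.mul_rpow hc.le (by positivity)]
  congr 2
  field_simp

/-- For exponents at least one, dividing by `K ≥ 1` divides the modular by at least `K`. -/
theorem varModular_div_le {p : ℝ → ℝ} {s : Set ℝ} (hs : MeasurableSet s)
    (hp_one : ∀ x ∈ s, 1 ≤ p x) {g : ℝ → ℝ≥0∞} {K : ℝ≥0∞} (hK1 : 1 ≤ K) :
    varModular p s (fun x => g x / K) ≤ varModular p s g / K := by
  rw [varModular, varModular, div_eq_mul_inv, ← lintegral_mul_const' _ _
    (ENNReal.inv_ne_top.2 (by positivity))]
  refine setLIntegral_mono' hs fun x hx => ?_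
  have hpx := hp_one x hx
  rw [ENNReal.div_rpow_of_nonneg _ _ (by linarith), div_eq_mul_inv]
  gcongr
  simpa using ENNReal.rpow_le_rpow_of_exponent_le hK1 hpx

theorem varNorm_le_mul_of_varModular_le {p : ℝ → ℝ} {s : Set ℝ} (hs : MeasurableSet s)
    (hp_one : ∀ x ∈ s, 1 ≤ p x) {g : ℝ → ℝ≥0∞} {K l : ℝ≥0∞} (hK1 : 1 ≤ K) (hK : K ≠ ∞)
    (hl0 : 0 < l) (hl : l < ∞) (h : varModular p s (fun x => g x / l) ≤ K) :
    varNorm p s g ≤ K * l := by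
  have hK0 : K ≠ 0 := (zero_lt_one.trans_le hK1).ne'
  refine sInf_le ⟨ENNReal.mul_pos hK0 hl0.ne', ENNReal.mul_lt_top hK.lt_top hl, ?_⟩
  calc varModular p s (fun x => g x / (K * l))
      = varModular p s (fun x => g x / l / K) := by
        congr 1; funext x
        rw [div_eq_mul_inv, div_eq_mul_inv, div_eq_mul_inv, mul_assoc,
          ENNReal.mul_inv (Or.inl hK0) (Or.inl hK), mul_comm K⁻¹]
    _ ≤ varModular p s (fun x => g x / l) / K := varModular_div_le hs hp_one hK1
    _ ≤ 1 := ENNReal.div_le_of_le_mul (by rwa [one_mul])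

theorem varModular_mono {p : ℝ → ℝ} {s : Set ℝ} (hs : MeasurableSet s)
    (hp : ∀ x ∈ s, 0 ≤ p x) {g h : ℝ → ℝ≥0∞} (hgh : ∀ x ∈ s, g x ≤ h x) :
    varModular p s g ≤ varModular p s h :=
  setLIntegral_mono' hs fun x hx => ENNReal.rpow_le_rpow (hgh x hx) (hp x hx)

theorem varModular_div_le_one_of_varNorm_lt {p : ℝ → ℝ} {s : Set ℝ} (hs : MeasurableSet s)
    (hp : ∀ x ∈ s, 0 ≤ p x) {g : ℝ → ℝ≥0∞} {l : ℝ≥0∞} (h : varNorm p s g < l) :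
    varModular p s (fun x => g x / l) ≤ 1 := by
  obtain ⟨l', ⟨_, _, h'⟩, hl'⟩ := sInf_lt_iff.1 h
  exact (varModular_mono hs hp fun x _ => ENNReal.div_le_div_left hl'.le _).trans h'

theorem varNorm_mono {p : ℝ → ℝ} {s t : Set ℝ}
    (hp : ∀ x ∈ t, 0 ≤ p x) (hst : s ⊆ t) (hs : MeasurableSet s) {g h : ℝ → ℝ≥0∞}
    (hgh : ∀ x ∈ s, g x ≤ h x) :
    varNorm p s g ≤ varNorm p t h := by
  refine sInf_le_sInf fun l ⟨h0, h1, h2⟩ => ⟨h0, h1, le_trans ?_ h2⟩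
  exact (varModular_mono hs (fun x hx => hp x (hst hx)) fun x hx =>
    ENNReal.div_le_div_right (hgh x hx) _).trans (lintegral_mono_set hst)

theorem lintegral_eq_varModular_inv_div {p : ℝ → ℝ} (hp_one : ∀ x ∈ Ioo (0 : ℝ) 1, 1 ≤ p x)
    {a : ℝ} (ha : a ∈ Ioo (0 : ℝ) 1) :
    ∫⁻ x in Ioo a 1, ENNReal.ofReal ((a ^ invConj p a * x ^ (-invConj p x)) ^ p x / x) =
      varModular p (Ioo a 1)
        (fun x => ENNReal.ofReal x⁻¹ / ENNReal.ofReal (a ^ (-invConj p a))) := by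
  refine setLIntegral_congr_fun measurableSet_Ioo fun x hx => ?_
  have hx1 : x ∈ Ioo (0 : ℝ) 1 := ⟨ha.1.trans hx.1, hx.2⟩
  simp only
  rw [ofReal_mul_rpow_neg_invConj_rpow_div (Real.rpow_pos_of_pos ha.1 _) hx1.1 (hp_one x hx1),
    ← Real.rpow_neg ha.1.le]

/-! ### Integral conditions and norm conditions -/

theorem varNorm_inv_le_of_lintegral_le {p : ℝ → ℝ} (hp_one : ∀ x ∈ Ioo (0 : ℝ) 1, 1 ≤ p x)
    {C : ℝ} (h : ∀ a ∈ Ioo (0 : ℝ) 1,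
      ∫⁻ x in Ioo a 1, ENNReal.ofReal ((a ^ invConj p a * x ^ (-invConj p x)) ^ p x / x)
        ≤ ENNReal.ofReal C) {a : ℝ} (ha : a ∈ Ioo (0 : ℝ) 1) :
    varNorm p (Ioo a 1) (fun x => ENNReal.ofReal x⁻¹)
      ≤ ENNReal.ofReal (max C 1 * a ^ (-invConj p a)) := by
  have hp : ∀ x ∈ Ioo a 1, 1 ≤ p x := fun x hx => hp_one x ⟨ha.1.trans hx.1, hx.2⟩
  have h' := h a ha
  rw [lintegral_eq_varModular_inv_div hp_one ha] at h'
  rw [ENNReal.ofReal_mul (by positivity)]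
  exact varNorm_le_mul_of_varModular_le measurableSet_Ioo hp
    (ENNReal.one_le_ofReal.2 (le_max_right _ _)) ENNReal.ofReal_ne_top
    (ENNReal.ofReal_pos.2 (Real.rpow_pos_of_pos ha.1 _)) ENNReal.ofReal_lt_top
    (h'.trans (ENNReal.ofReal_le_ofReal (le_max_left _ _)))

theorem lintegral_le_of_varNorm_inv_le {p : ℝ → ℝ} (hp_one : ∀ x ∈ Ioo (0 : ℝ) 1, 1 ≤ p x)
    {P : ℝ} (hP : ∀ x ∈ Ioo (0 : ℝ) 1, p x ≤ P) {C : ℝ} (hC : 0 < C) {a : ℝ}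
    (ha : a ∈ Ioo (0 : ℝ) 1)
    (h : varNorm p (Ioo a 1) (fun x => ENNReal.ofReal x⁻¹)
      ≤ ENNReal.ofReal (C * a ^ (-invConj p a))) :
    ∫⁻ x in Ioo a 1, ENNReal.ofReal ((a ^ invConj p a * x ^ (-invConj p x)) ^ p x / x)
      ≤ ENNReal.ofReal ((C + 1) ^ P) := by
  have hsub : ∀ x ∈ Ioo a 1, x ∈ Ioo (0 : ℝ) 1 := fun x hx => ⟨ha.1.trans hx.1, hx.2⟩
  have hw : 0 < a ^ (-invConj p a) := Real.rpow_pos_of_pos ha.1 _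
  have hlt : varNorm p (Ioo a 1) (fun x => ENNReal.ofReal x⁻¹)
      < ENNReal.ofReal ((C + 1) * a ^ (-invConj p a)) :=
    h.trans_lt ((ENNReal.ofReal_lt_ofReal_iff (by positivity)).2 (by nlinarith))
  have h1 := varModular_div_le_one_of_varNorm_lt measurableSet_Ioo
    (fun x hx => zero_le_one.trans (hp_one x (hsub x hx))) hlt
  rw [lintegral_eq_varModular_inv_div hp_one ha]
  calc varModular p (Ioo a 1) (fun x => ENNReal.ofReal x⁻¹ / ENNReal.ofReal (a ^ (-invConj p a)))
      ≤ ∫⁻ x in Ioo a 1, ENNReal.ofReal ((C + 1) ^ P) *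
          (ENNReal.ofReal x⁻¹ / ENNReal.ofReal ((C + 1) * a ^ (-invConj p a))) ^ p x := by
        refine setLIntegral_mono' measurableSet_Ioo fun x hx => ?_
        have hx0 := (hsub x hx).1
        beta_reduce
        rw [← ENNReal.ofReal_div_of_pos hw, ← ENNReal.ofReal_div_of_pos (by positivity),
          ENNReal.ofReal_rpow_of_pos (by positivity), ENNReal.ofReal_rpow_of_pos (by positivity),
          ← ENNReal.ofReal_mul (by positivity)]
        refine ENNReal.ofReal_le_ofReal ?_
        calc (x⁻¹ / a ^ (-invConj p a)) ^ p x
            = (C + 1) ^ p x * (x⁻¹ / ((C + 1) * a ^ (-invConj p a))) ^ p x := by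
              rw [← Real.mul_rpow (by positivity) (by positivity)]
              congr 1
              field_simp
          _ ≤ _ := by
              gcongr
              · linarith
              · exact hP x (hsub x hx)
    _ = ENNReal.ofReal ((C + 1) ^ P) * varModular p (Ioo a 1)
          (fun x => ENNReal.ofReal x⁻¹ / ENNReal.ofReal ((C + 1) * a ^ (-invConj p a))) :=
        lintegral_const_mul' _ _ ENNReal.ofReal_ne_top
    _ ≤ ENNReal.ofReal ((C + 1) ^ P) * 1 := by gcongr
    _ = _ := mul_one _

/-- Testing Hardy's inequality with `a ^ (-1 / p a)` on `(0, a)`: this function has norm at most one,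
its integral is `a ^ (1 / p' a)`, and hence `Hf = a ^ (1 / p' a)` on `(a, 1)`. -/
theorem varNorm_inv_le_of_hardy {p : ℝ → ℝ} (hp_one : ∀ x ∈ Ioo (0 : ℝ) 1, 1 ≤ p x)
    (hp_mono : MonotoneOn p (Ioo 0 1)) {C : ℝ} (hC : 0 < C)
    (h : ∀ f : ℝ → ℝ, AEMeasurable f (volume.restrict (Ioo 0 1)) →
      (∀ x ∈ Ioo (0 : ℝ) 1, 0 ≤ f x) →
        varNorm p (Ioo 0 1)
            (fun x => ENNReal.ofReal x⁻¹ * hardyOp (fun t => ENNReal.ofReal (f t)) x)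
          ≤ ENNReal.ofReal C * varNorm p (Ioo 0 1) (fun x => ENNReal.ofReal (f x)))
    {a : ℝ} (ha : a ∈ Ioo (0 : ℝ) 1) :
    varNorm p (Ioo a 1) (fun x => ENNReal.ofReal x⁻¹)
      ≤ ENNReal.ofReal ((C + 1) * a ^ (-invConj p a)) := by
  have hsub : Ioo a 1 ⊆ Ioo (0 : ℝ) 1 := Ioo_subset_Ioo_left ha.1.le
  have ha0 := ha.1
  have hpa := hp_one a ha
  set c : ℝ := (a ^ (p a)⁻¹)⁻¹ with hc
  have hc0 : 0 < c := by positivity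
  have hca : c * a = a ^ invConj p a := by
    rw [invConj_eq hpa, Real.rpow_sub ha0, Real.rpow_one, one_div, hc]
    field_simp
  set f : ℝ → ℝ := (Ioo 0 a).indicator fun _ => c with hf
  have hf0 : ∀ x, 0 ≤ f x := fun x => indicator_nonneg (fun _ _ => hc0.le) x
  have hfm : Measurable f := measurable_const.indicator measurableSet_Ioo
  have hnorm : varNorm p (Ioo 0 1) (fun x => ENNReal.ofReal (f x)) ≤ 1 := by
    refine sInf_le ⟨one_pos, ENNReal.one_lt_top, ?_⟩
    calc varModular p (Ioo 0 1) (fun x => ENNReal.ofReal (f x) / 1)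
        ≤ ∫⁻ x in Ioo 0 1, (Ioo 0 a).indicator (fun _ => ENNReal.ofReal a⁻¹) x := by
          refine setLIntegral_mono' measurableSet_Ioo fun x hx => ?_
          have hpx := hp_one x hx
          beta_reduce
          rw [div_one]
          by_cases hxa : x ∈ Ioo 0 a
          · rw [hf, indicator_of_mem hxa, indicator_of_mem hxa, ENNReal.ofReal_rpow_of_pos hc0]
            refine ENNReal.ofReal_le_ofReal ?_
            rw [hc, Real.inv_rpow (by positivity), ← Real.rpow_mul ha0.le]
            refine inv_anti₀ ha0 ?_
            conv_lhs => rw [← Real.rpow_one a]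
            refine Real.rpow_le_rpow_of_exponent_ge ha0 ha.2.le ?_
            rw [inv_mul_le_one₀ (by linarith)]
            exact hp_mono hx ha hxa.2.le
          · rw [hf, indicator_of_notMem hxa, indicator_of_notMem hxa, ENNReal.ofReal_zero,
              ENNReal.zero_rpow_of_pos (by linarith)]
      _ ≤ ∫⁻ x, (Ioo 0 a).indicator (fun _ => ENNReal.ofReal a⁻¹) x := setLIntegral_le_lintegral _ _
      _ = 1 := by
          rw [lintegral_indicator_const measurableSet_Ioo, Real.volume_Ioo, sub_zero,
            ← ENNReal.ofReal_mul (by positivity), inv_mul_cancel₀ ha0.ne', ENNReal.ofReal_one]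
  have hH : ∀ x ∈ Ioo a 1, ENNReal.ofReal (a ^ invConj p a) ≤
      hardyOp (fun t => ENNReal.ofReal (f t)) x := by
    intro x hx
    calc ENNReal.ofReal (a ^ invConj p a) = ENNReal.ofReal (c * (a - 0)) := by rw [sub_zero, hca]
      _ ≤ ∫⁻ t in Ioo 0 a, ENNReal.ofReal (f t) :=
          ofReal_mul_sub_le_lintegral hc0.le fun t ht => by rw [hf, indicator_of_mem ht]
      _ ≤ _ := lintegral_mono_set (Ioo_subset_Ioo_right hx.1.le)
  have hA : 0 < a ^ invConj p a := Real.rpow_pos_of_pos ha0 _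
  have h1 : varNorm p (Ioo a 1) (fun x => ENNReal.ofReal x⁻¹ * ENNReal.ofReal (a ^ invConj p a))
      ≤ ENNReal.ofReal C :=
    calc _ ≤ varNorm p (Ioo 0 1)
            (fun x => ENNReal.ofReal x⁻¹ * hardyOp (fun t => ENNReal.ofReal (f t)) x) :=
          varNorm_mono (fun x hx => zero_le_one.trans (hp_one x hx)) hsub
            measurableSet_Ioo fun x hx => by gcongr; exact hH x hx
      _ ≤ ENNReal.ofReal C * 1 := (h f hfm.aemeasurable fun x _ => hf0 x).trans (by gcongr)
      _ = _ := mul_one _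
  have h2 := varModular_div_le_one_of_varNorm_lt measurableSet_Ioo
    (fun x hx => zero_le_one.trans (hp_one x (hsub hx)))
    (h1.trans_lt ((ENNReal.ofReal_lt_ofReal_iff (by positivity)).2 (lt_add_one C)))
  refine sInf_le ⟨ENNReal.ofReal_pos.2 (by positivity), ENNReal.ofReal_lt_top, ?_⟩
  convert h2 using 3 with x
  rw [← ENNReal.ofReal_mul' hA.le, ← ENNReal.ofReal_div_of_pos (by positivity),
    ← ENNReal.ofReal_div_of_pos (by positivity), Real.rpow_neg ha0.le]
  congr 1
  field_simp

/-- The integral condition with exponent `p x` implies power growth of the weight. Once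
`a ^ (1 / p' a) * x ^ (-1 / p' x)` is known to be bounded by some `K`, the exponent `p x` can be
replaced by the larger constant `P` at the cost of the factor `K ^ P`. -/
theorem exists_almostDecreasingOn_of_lintegral_rpow_le {p : ℝ → ℝ}
    (hp_one : ∀ x ∈ Ioo (0 : ℝ) 1, 1 ≤ p x) (hp_mono : MonotoneOn p (Ioo 0 1))
    {P : ℝ} (hP : ∀ x ∈ Ioo (0 : ℝ) 1, p x ≤ P) {C : ℝ} (hC : 0 < C)
    (h : ∀ a ∈ Ioo (0 : ℝ) 1,
      ∫⁻ x in Ioo a 1, ENNReal.ofReal ((a ^ invConj p a * x ^ (-invConj p x)) ^ p x / x)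
        ≤ ENNReal.ofReal C) :
    ∃ ε : ℝ, 0 < ε ∧ AlmostDecreasingOn (fun x => x ^ (-invConj p x + ε)) (Ioo 0 1) := by
  have hq0 : ∀ x ∈ Ioo (0 : ℝ) 1, 0 ≤ invConj p x := fun x _ => invConj_nonneg p x
  have hq1 : ∀ x ∈ Ioo (0 : ℝ) 1, invConj p x ≤ 1 := fun x hx => invConj_le_one (hp_one x hx)
  have hqm := monotoneOn_invConj hp_one hp_mono
  have hP0 : 0 < P := by linarith [hp_one (1 / 2) (by norm_num), hP (1 / 2) (by norm_num)]
  set K : ℝ := 2 * (2 * C + 1) with hK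
  have hK1 : 1 ≤ K := by linarith
  have hbound : ∀ a ∈ Ioo (0 : ℝ) 1, ∀ x ∈ Ioo a 1,
      a ^ invConj p a * x ^ (-invConj p x) ≤ K := by
    intro a ha x hx
    have hx1 : x ∈ Ioo (0 : ℝ) 1 := ⟨ha.1.trans hx.1, hx.2⟩
    have hx0 := hx1.1
    have hA : 0 < a ^ invConj p a := Real.rpow_pos_of_pos ha.1 _
    rcases le_total (1 / 2) x with hx2 | hx2
    · have h1 := rpow_neg_le_two hx1 hx2 (hq1 x hx1)
      have h2 : a ^ invConj p a ≤ 1 := Real.rpow_le_one ha.1.le ha.2.le (hq0 a ha)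
      calc a ^ invConj p a * x ^ (-invConj p x) ≤ 1 * 2 := by gcongr
        _ ≤ K := by linarith
    set b := a ^ invConj p a * x ^ (-invConj p x) / 2 with hb
    -- A large value at `x` persists, up to the factor two, on `(x, 2 * x)`, where the power `p`
    -- only increases it; this makes the integral larger than `C`.
    by_contra! hcon
    have hb1 : 2 * C + 1 < b := by linarith
    have hlow : ENNReal.ofReal (b / (2 * x) * (2 * x - x)) ≤ ENNReal.ofReal C := by
      refine (ofReal_mul_sub_le_lintegral (by positivity) fun y hy => ?_).trans
        ((lintegral_mono_set (Ioo_subset_Ioo hx.1.le (by linarith))).trans (h a ha))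
      have hy1 : y ∈ Ioo (0 : ℝ) 1 := ⟨hx0.trans hy.1, by linarith [hy.2]⟩
      have hy0 := hy1.1
      have h1 : b ≤ a ^ invConj p a * y ^ (-invConj p y) := by
        have := mul_le_mul_of_nonneg_left
          (rpow_neg_le_two_mul hq1 hqm hx1 hy1 hy.1.le hy.2.le (hq0 x hx1)) hA.le
        linarith
      have h2 : b ≤ (a ^ invConj p a * y ^ (-invConj p y)) ^ p y :=
        h1.trans (Real.self_le_rpow_of_one_le (by linarith) (hp_one y hy1))
      gcongr
      exact hy.2.le
    rw [ENNReal.ofReal_le_ofReal_iff hC.le] at hlow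
    have : b / (2 * x) * (2 * x - x) = b / 2 := by field_simp; ring
    linarith
  refine exists_almostDecreasingOn_of_lintegral_le hq0 hq1 hqm (m := P) (C := C * K ^ P) hP0
    (by positivity) fun a ha => ?_
  have hA : 0 < a ^ invConj p a := Real.rpow_pos_of_pos ha.1 _
  have hA' : a ^ (-invConj p a) = (a ^ invConj p a)⁻¹ := Real.rpow_neg ha.1.le _
  calc ∫⁻ x in Ioo a 1, ENNReal.ofReal ((x ^ (-invConj p x)) ^ P / x)
      ≤ ∫⁻ x in Ioo a 1, ENNReal.ofReal (K ^ P * (a ^ (-invConj p a)) ^ P) *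
          ENNReal.ofReal ((a ^ invConj p a * x ^ (-invConj p x)) ^ p x / x) := by
        refine setLIntegral_mono' measurableSet_Ioo fun x hx => ?_
        have hx1 : x ∈ Ioo (0 : ℝ) 1 := ⟨ha.1.trans hx.1, hx.2⟩
        have hx0 := hx1.1
        have ha0 := ha.1
        rw [← ENNReal.ofReal_mul (by positivity)]
        refine ENNReal.ofReal_le_ofReal ?_
        set W := a ^ invConj p a * x ^ (-invConj p x) with hW
        have hW0 : 0 < W := by positivity
        have h1 : (W / K) ^ P ≤ W ^ p x :=
          calc (W / K) ^ P ≤ (W / K) ^ p x :=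
                Real.rpow_le_rpow_of_exponent_ge (by positivity)
                  ((div_le_one (by linarith)).2 (hbound a ha x hx)) (hP x hx1)
            _ ≤ W ^ p x := Real.rpow_le_rpow (by positivity) (div_le_self hW0.le hK1)
                (zero_le_one.trans (hp_one x hx1))
        have h2 : x ^ (-invConj p x) = K * a ^ (-invConj p a) * (W / K) := by
          rw [hW, hA']; field_simp
        rw [h2, Real.mul_rpow (by positivity) (by positivity),
          Real.mul_rpow (by positivity) (by positivity), ← mul_div_assoc]
        gcongr
    _ = ENNReal.ofReal (K ^ P * (a ^ (-invConj p a)) ^ P) *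
          ∫⁻ x in Ioo a 1, ENNReal.ofReal ((a ^ invConj p a * x ^ (-invConj p x)) ^ p x / x) :=
        lintegral_const_mul' _ _ ENNReal.ofReal_ne_top
    _ ≤ ENNReal.ofReal (K ^ P * (a ^ (-invConj p a)) ^ P) * ENNReal.ofReal C := by
        gcongr; exact h a ha
    _ = _ := by
        rw [← ENNReal.ofReal_mul (by have := ha.1; positivity)]
        congr 1; ring

theorem lintegral_rpow_neg_div_le_of_almostDecreasing {q : ℝ → ℝ} {ε C : ℝ} (hε : 0 < ε)
    (hC : 0 < C)
    (h : ∀ x ∈ Ioo (0 : ℝ) 1, ∀ y ∈ Ioo (0 : ℝ) 1, x ≤ y →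
        y ^ (-q y) ≤ C * x ^ (-q x) * (x / y) ^ ε) {a : ℝ} (ha : a ∈ Ioo (0 : ℝ) 1) :
    ∫⁻ x in Ioo a 1, ENNReal.ofReal (x ^ (-q x) / x) ≤ ENNReal.ofReal (C / ε * a ^ (-q a)) := by
  have ha0 := ha.1
  calc ∫⁻ x in Ioo a 1, ENNReal.ofReal (x ^ (-q x) / x)
      ≤ ∫⁻ x in Ioo a 1, ENNReal.ofReal (C * a ^ (-q a)) *
          ENNReal.ofReal ((a / x) ^ ε / x) := by
        refine setLIntegral_mono' measurableSet_Ioo fun x hx => ?_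
        have hx1 : x ∈ Ioo (0 : ℝ) 1 := ⟨ha.1.trans hx.1, hx.2⟩
        have hx0 := hx1.1
        rw [← ENNReal.ofReal_mul (by positivity), ← mul_div_assoc]
        have := h a ha x hx1 hx.1.le
        gcongr
    _ = ENNReal.ofReal (C * a ^ (-q a)) * ∫⁻ x in Ioo a 1, ENNReal.ofReal ((a / x) ^ ε / x) :=
        lintegral_const_mul' _ _ ENNReal.ofReal_ne_top
    _ ≤ ENNReal.ofReal (C * a ^ (-q a)) * ENNReal.ofReal (1 / ε) := by
        gcongr; exact lintegral_Ioo_div_rpow_le ha0 hε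
    _ = _ := by
        rw [← ENNReal.ofReal_mul (by positivity)]
        congr 1; ring

theorem lintegral_rpow_div_le_of_almostDecreasing {p : ℝ → ℝ}
    (hp_one : ∀ x ∈ Ioo (0 : ℝ) 1, 1 ≤ p x) {P : ℝ} (hP : ∀ x ∈ Ioo (0 : ℝ) 1, p x ≤ P)
    {ε C : ℝ} (hε : 0 < ε)
    (h : ∀ x ∈ Ioo (0 : ℝ) 1, ∀ y ∈ Ioo (0 : ℝ) 1, x ≤ y →
        y ^ (-invConj p y) ≤ C * x ^ (-invConj p x) * (x / y) ^ ε)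
    {a : ℝ} (ha : a ∈ Ioo (0 : ℝ) 1) :
    ∫⁻ x in Ioo a 1, ENNReal.ofReal ((a ^ invConj p a * x ^ (-invConj p x)) ^ p x / x)
      ≤ ENNReal.ofReal (max C 1 ^ P / ε) := by
  have ha0 := ha.1
  have hA' : a ^ (-invConj p a) = (a ^ invConj p a)⁻¹ := Real.rpow_neg ha.1.le _
  have hA : 0 < a ^ invConj p a := Real.rpow_pos_of_pos ha.1 _
  calc ∫⁻ x in Ioo a 1, ENNReal.ofReal ((a ^ invConj p a * x ^ (-invConj p x)) ^ p x / x)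
      ≤ ∫⁻ x in Ioo a 1, ENNReal.ofReal (max C 1 ^ P) * ENNReal.ofReal ((a / x) ^ ε / x) := by
        refine setLIntegral_mono' measurableSet_Ioo fun x hx => ?_
        have hx1 : x ∈ Ioo (0 : ℝ) 1 := ⟨ha.1.trans hx.1, hx.2⟩
        have hx0 := hx1.1
        have hpx := hp_one x hx1
        rw [← ENNReal.ofReal_mul (by positivity), ← mul_div_assoc]
        have h1 : a ^ invConj p a * x ^ (-invConj p x) ≤ max C 1 * (a / x) ^ ε := by
          calc a ^ invConj p a * x ^ (-invConj p x)
              ≤ a ^ invConj p a * (C * a ^ (-invConj p a) * (a / x) ^ ε) := by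
                gcongr; exact h a ha x hx1 hx.1.le
            _ = C * (a / x) ^ ε := by rw [hA']; field_simp
            _ ≤ _ := by gcongr; exact le_max_left _ _
        have h2 : ((a / x) ^ ε) ≤ 1 :=
          Real.rpow_le_one (by positivity) ((div_le_one hx0).2 hx.1.le) hε.le
        gcongr
        calc (a ^ invConj p a * x ^ (-invConj p x)) ^ p x
            ≤ (max C 1 * (a / x) ^ ε) ^ p x := by gcongr
          _ = max C 1 ^ p x * ((a / x) ^ ε) ^ p x := Real.mul_rpow (by positivity) (by positivity)
          _ ≤ max C 1 ^ P * (a / x) ^ ε := by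
              gcongr
              · exact le_max_right _ _
              · exact hP x hx1
              · simpa using Real.rpow_le_rpow_of_exponent_ge (by positivity) h2 hpx
    _ = ENNReal.ofReal (max C 1 ^ P) * ∫⁻ x in Ioo a 1, ENNReal.ofReal ((a / x) ^ ε / x) :=
        lintegral_const_mul' _ _ ENNReal.ofReal_ne_top
    _ ≤ ENNReal.ofReal (max C 1 ^ P) * ENNReal.ofReal (1 / ε) := by
        gcongr; exact lintegral_Ioo_div_rpow_le ha0 hε
    _ = _ := by
        rw [← ENNReal.ofReal_mul (by positivity)]
        congr 1; ring

/-! ### Hardy's inequality -/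

/-- Jensen's inequality for the power `r ≥ 1` and a kernel `k` of arbitrary total mass. -/
theorem rpow_lintegral_mul_le {α : Type*} [MeasurableSpace α] {μ : Measure α} {k g : α → ℝ≥0∞}
    (hk : AEMeasurable k μ) (hg : AEMeasurable g μ) {r : ℝ} (hr : 1 ≤ r) :
    (∫⁻ a, k a * g a ∂μ) ^ r ≤ (∫⁻ a, k a ∂μ) ^ (r - 1) * ∫⁻ a, k a * g a ^ r ∂μ := by
  have hr0 : 0 < r := by linarith
  have hr1 : 0 ≤ 1 - 1 / r := by
    rw [sub_nonneg, div_le_one hr0]; exact hr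
  have h := ENNReal.lintegral_mul_norm_pow_le hk (hk.mul (hg.pow_const r)) (p := 1 - 1 / r)
    (q := 1 / r) hr1 (by positivity) (by ring)
  have e : ∀ a, k a ^ (1 - 1 / r) * (k * fun a => g a ^ r) a ^ (1 / r) = k a * g a := fun a => by
    rw [Pi.mul_apply, ENNReal.mul_rpow_of_nonneg _ _ (by positivity), ← ENNReal.rpow_mul,
      mul_one_div_cancel hr0.ne', ENNReal.rpow_one, ← mul_assoc,
      ← ENNReal.rpow_add_of_nonneg _ _ hr1 (by positivity), sub_add_cancel, ENNReal.rpow_one]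
  simp_rw [e] at h
  calc (∫⁻ a, k a * g a ∂μ) ^ r
      ≤ ((∫⁻ a, k a ∂μ) ^ (1 - 1 / r) * (∫⁻ a, k a * g a ^ r ∂μ) ^ (1 / r)) ^ r :=
        ENNReal.rpow_le_rpow h hr0.le
    _ = _ := by
        rw [ENNReal.mul_rpow_of_nonneg _ _ hr0.le, ← ENNReal.rpow_mul, ← ENNReal.rpow_mul,
          one_div_mul_cancel hr0.ne', ENNReal.rpow_one, sub_mul, one_mul,
          one_div_mul_cancel hr0.ne']

/-- The averaging operator with kernel `(t / x) ^ ε / x` on `t < x` is bounded on `L¹(0, 1)`. -/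
theorem lintegral_lintegral_kernel_le {h : ℝ → ℝ≥0∞}
    (hh : AEMeasurable h (volume.restrict (Ioo 0 1))) {ε : ℝ} (hε : 0 < ε) :
    ∫⁻ x in Ioo 0 1, ENNReal.ofReal x⁻¹ * ∫⁻ t in Ioo 0 x, ENNReal.ofReal ((t / x) ^ ε) * h t
      ≤ ENNReal.ofReal (1 / ε) * ∫⁻ t in Ioo 0 1, h t := by
  set k : ℝ → ℝ → ℝ≥0∞ := fun x t =>
    {z : ℝ × ℝ | z.2 < z.1}.indicator (fun z => ENNReal.ofReal ((z.2 / z.1) ^ ε / z.1)) (x, t)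
    with hk
  have hkm : Measurable (Function.uncurry k) := by
    have : Measurable fun z : ℝ × ℝ => ENNReal.ofReal ((z.2 / z.1) ^ ε / z.1) := by fun_prop
    exact this.indicator (measurableSet_lt measurable_snd measurable_fst)
  have hk_lt : ∀ {x t : ℝ}, t < x → k x t = ENNReal.ofReal ((t / x) ^ ε / x) := fun {x t} htx =>
    indicator_of_mem (show (x, t) ∈ {z : ℝ × ℝ | z.2 < z.1} from htx) _
  have hk_not_lt : ∀ {x t : ℝ}, ¬ t < x → k x t = 0 := fun {x t} htx =>
    indicator_of_notMem (show (x, t) ∉ {z : ℝ × ℝ | z.2 < z.1} from htx) _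
  calc ∫⁻ x in Ioo 0 1, ENNReal.ofReal x⁻¹ * ∫⁻ t in Ioo 0 x, ENNReal.ofReal ((t / x) ^ ε) * h t
      = ∫⁻ x in Ioo 0 1, ∫⁻ t in Ioo 0 1, k x t * h t := by
        refine setLIntegral_congr_fun measurableSet_Ioo fun x hx => ?_
        rw [← lintegral_const_mul' _ _ ENNReal.ofReal_ne_top,
          ← lintegral_indicator measurableSet_Ioo, ← lintegral_indicator measurableSet_Ioo]
        refine lintegral_congr fun t => ?_
        by_cases ht : t ∈ Ioo 0 x
        · have hx0 := hx.1
          have ht1 : t ∈ Ioo (0 : ℝ) 1 := ⟨ht.1, ht.2.trans hx.2⟩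
          rw [indicator_of_mem ht, indicator_of_mem ht1, hk_lt ht.2, ← mul_assoc,
            ← ENNReal.ofReal_mul (by positivity),
            div_eq_inv_mul ((t / x) ^ ε)]
        · rw [indicator_of_notMem ht]
          by_cases ht1 : t ∈ Ioo (0 : ℝ) 1
          · rw [indicator_of_mem ht1, hk_not_lt (fun h' => ht ⟨ht1.1, h'⟩), zero_mul]
          · rw [indicator_of_notMem ht1]
    _ = ∫⁻ t in Ioo 0 1, ∫⁻ x in Ioo 0 1, k x t * h t :=
        lintegral_lintegral_swap (hkm.aemeasurable.mul hh.comp_snd)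
    _ ≤ ∫⁻ t in Ioo 0 1, ENNReal.ofReal (1 / ε) * h t := by
        refine setLIntegral_mono' measurableSet_Ioo fun t ht => ?_
        have hkt : Measurable fun x => k x t := hkm.comp measurable_prodMk_right
        rw [lintegral_mul_const _ hkt]
        gcongr
        calc ∫⁻ x in Ioo 0 1, k x t
            ≤ ∫⁻ x in Ioo t 1, ENNReal.ofReal ((t / x) ^ ε / x) := by
              rw [← lintegral_indicator measurableSet_Ioo, ← lintegral_indicator measurableSet_Ioo]
              refine lintegral_mono fun x => ?_
              by_cases hx : x ∈ Ioo (0 : ℝ) 1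
              · rw [indicator_of_mem hx]
                by_cases htx : t < x
                · have hx1 : x ∈ Ioo t 1 := ⟨htx, hx.2⟩
                  rw [hk_lt htx, indicator_of_mem hx1]
                · rw [hk_not_lt htx]
                  exact zero_le
              · rw [indicator_of_notMem hx]
                exact zero_le
          _ ≤ _ := lintegral_Ioo_div_rpow_le ht.1 hε
    _ = _ := lintegral_const_mul' _ _ ENNReal.ofReal_ne_top

/-- Jensen's inequality for the kernel `(t / x) ^ ε / t` on `(0, x)` with the variable exponent: the
outer exponent `p x` becomes `p t` inside, by monotonicity of `p` where `g ≤ 1` and by the bound on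
the modular where `g ≥ 1`. -/
theorem rpow_lintegral_kernel_le {p : ℝ → ℝ} (hp_one : ∀ x ∈ Ioo (0 : ℝ) 1, 1 ≤ p x)
    (hp_mono : MonotoneOn p (Ioo 0 1)) {P : ℝ} (hP : ∀ x ∈ Ioo (0 : ℝ) 1, p x ≤ P)
    {ε : ℝ} (hε : 0 < ε) {g : ℝ → ℝ≥0∞} (hg : AEMeasurable g (volume.restrict (Ioo 0 1)))
    (hmod : ∫⁻ t in Ioo 0 1, ENNReal.ofReal t⁻¹ * g t ^ p t ≤ 1) {x : ℝ}
    (hx : x ∈ Ioo (0 : ℝ) 1) :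
    (∫⁻ t in Ioo 0 x, ENNReal.ofReal ((t / x) ^ ε / t) * g t) ^ p x ≤
      2 ^ P * (ENNReal.ofReal (max 1 (1 / ε) ^ P) + 1) *
        ∫⁻ t in Ioo 0 x, ENNReal.ofReal ((t / x) ^ ε / t) * g t ^ p t := by
  set k : ℝ → ℝ≥0∞ := fun t => ENNReal.ofReal ((t / x) ^ ε / t) with hk
  set M := ∫⁻ t in Ioo 0 x, k t * g t ^ p t with hM
  have hx0 := hx.1
  have hpx := hp_one x hx
  have hsub : Ioo 0 x ⊆ Ioo (0 : ℝ) 1 := Ioo_subset_Ioo_right hx.2.le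
  have hkm : Measurable k := by fun_prop
  have hgx : AEMeasurable g (volume.restrict (Ioo 0 x)) :=
    hg.mono_measure (Measure.restrict_mono_set _ hsub)
  have hmin : AEMeasurable (fun t => min (g t) 1) (volume.restrict (Ioo 0 x)) :=
    hgx.min aemeasurable_const
  have hkmin : AEMeasurable (fun t => k t * min (g t) 1) (volume.restrict (Ioo 0 x)) :=
    hkm.aemeasurable.mul hmin
  -- The kernel is at most `1 / t`.
  have hM1 : M ≤ 1 := by
    refine le_trans ?_ ((lintegral_mono_set hsub).trans hmod)
    refine setLIntegral_mono' measurableSet_Ioo fun t ht => ?_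
    have ht0 := ht.1
    simp only [hk]
    gcongr
    rw [div_eq_mul_inv]
    refine mul_le_of_le_one_left (by positivity) ?_
    exact Real.rpow_le_one (by positivity) ((div_le_one hx0).2 ht.2.le) hε.le
  -- `g ≤ min g 1 + g ^ p` pointwise, since `g ≤ g ^ p` where `g ≥ 1`.
  have hsplit : ∫⁻ t in Ioo 0 x, k t * g t ≤ (∫⁻ t in Ioo 0 x, k t * min (g t) 1) + M := by
    rw [hM, ← lintegral_add_left' hkmin]
    refine setLIntegral_mono' measurableSet_Ioo fun t ht => ?_
    rw [← mul_add]
    gcongr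
    rcases le_total (g t) 1 with h1 | h1
    · rw [min_eq_left h1]; exact le_self_add
    · refine le_trans ?_ le_add_self
      simpa using ENNReal.rpow_le_rpow_of_exponent_le h1 (hp_one t (hsub ht))
  have hsmall : (∫⁻ t in Ioo 0 x, k t * min (g t) 1) ^ p x ≤
      ENNReal.ofReal (max 1 (1 / ε) ^ P) * M := by
    refine (rpow_lintegral_mul_le hkm.aemeasurable hmin hpx).trans ?_
    gcongr ?_ * ?_
    · calc (∫⁻ t in Ioo 0 x, k t) ^ (p x - 1)
          ≤ ENNReal.ofReal (max 1 (1 / ε)) ^ (p x - 1) := by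
            refine ENNReal.rpow_le_rpow ?_ (by linarith)
            exact (lintegral_Ioo_zero_div_rpow_le hx0 hε).trans
              (ENNReal.ofReal_le_ofReal (le_max_right _ _))
        _ ≤ ENNReal.ofReal (max 1 (1 / ε)) ^ P :=
            ENNReal.rpow_le_rpow_of_exponent_le (ENNReal.one_le_ofReal.2 (le_max_left _ _))
              (by linarith [hP x hx])
        _ = _ := ENNReal.ofReal_rpow_of_pos (by positivity)
    · refine setLIntegral_mono' measurableSet_Ioo fun t ht => ?_
      gcongr
      -- `p t ≤ p x`, and a larger exponent decreases the powers of a number at most one.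
      calc min (g t) 1 ^ p x ≤ min (g t) 1 ^ p t :=
            ENNReal.rpow_le_rpow_of_exponent_ge (min_le_right _ _)
              (hp_mono (hsub ht) hx ht.2.le)
        _ ≤ g t ^ p t := ENNReal.rpow_le_rpow (min_le_left _ _)
            (by linarith [hp_one t (hsub ht)])
  calc (∫⁻ t in Ioo 0 x, k t * g t) ^ p x
      ≤ ((∫⁻ t in Ioo 0 x, k t * min (g t) 1) + M) ^ p x :=
        ENNReal.rpow_le_rpow hsplit (by linarith)
    _ ≤ 2 ^ (p x - 1) * ((∫⁻ t in Ioo 0 x, k t * min (g t) 1) ^ p x + M ^ p x) :=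
        ENNReal.rpow_add_le_mul_rpow_add_rpow _ _ hpx
    _ ≤ 2 ^ P * (ENNReal.ofReal (max 1 (1 / ε) ^ P) * M + M) := by
        gcongr
        · exact one_le_two
        · linarith [hP x hx]
        · simpa using ENNReal.rpow_le_rpow_of_exponent_ge hM1 hpx
    _ = _ := by ring

/-- Modular form of Hardy's inequality, with `g t = t ^ (1 / p t) * F t` in the role of the function
whose modular is taken with respect to `dt / t`. -/
theorem exists_varModular_hardy_le {p : ℝ → ℝ} (hp_one : ∀ x ∈ Ioo (0 : ℝ) 1, 1 ≤ p x)
    (hp_mono : MonotoneOn p (Ioo 0 1)) {P : ℝ} (hP : ∀ x ∈ Ioo (0 : ℝ) 1, p x ≤ P)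
    {ε C : ℝ} (hε : 0 < ε)
    (h : ∀ x ∈ Ioo (0 : ℝ) 1, ∀ y ∈ Ioo (0 : ℝ) 1, x ≤ y →
        y ^ (-invConj p y) ≤ C * x ^ (-invConj p x) * (x / y) ^ ε) :
    ∃ K : ℝ≥0∞, 1 ≤ K ∧ K ≠ ∞ ∧ ∀ F : ℝ → ℝ≥0∞, AEMeasurable F (volume.restrict (Ioo 0 1)) →
      varModular p (Ioo 0 1) F ≤ 1 →
        varModular p (Ioo 0 1) (fun x => ENNReal.ofReal x⁻¹ * hardyOp F x) ≤ K := by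
  set K₁ : ℝ≥0∞ := 2 ^ P * (ENNReal.ofReal (max 1 (1 / ε) ^ P) + 1) with hK₁
  have hK₁t : K₁ ≠ ∞ := by
    refine ENNReal.mul_ne_top ?_ (ENNReal.add_ne_top.2 ⟨ENNReal.ofReal_ne_top, ENNReal.one_ne_top⟩)
    rw [← ENNReal.ofReal_ofNat, ENNReal.ofReal_rpow_of_pos two_pos]
    exact ENNReal.ofReal_ne_top
  set K₂ : ℝ≥0∞ := ENNReal.ofReal (max 1 C ^ P) * K₁ with hK₂
  have hK₂t : K₂ ≠ ∞ := ENNReal.mul_ne_top ENNReal.ofReal_ne_top hK₁t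
  refine ⟨max 1 (K₂ * ENNReal.ofReal (1 / ε)), le_max_left _ _,
    (max_lt ENNReal.one_lt_top (ENNReal.mul_lt_top hK₂t.lt_top ENNReal.ofReal_lt_top)).ne,
    fun F hF hmod => le_trans ?_ (le_max_right _ _)⟩
  have hpm : AEMeasurable p (volume.restrict (Ioo 0 1)) :=
    aemeasurable_restrict_of_monotoneOn measurableSet_Ioo hp_mono
  set g : ℝ → ℝ≥0∞ := fun t => ENNReal.ofReal (t ^ (p t)⁻¹) * F t with hg
  have hgm : AEMeasurable g (volume.restrict (Ioo 0 1)) :=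
    (aemeasurable_id.pow hpm.inv).ennreal_ofReal.mul hF
  have hgp : ∀ t ∈ Ioo (0 : ℝ) 1, g t ^ p t = ENNReal.ofReal t * F t ^ p t := by
    intro t ht
    have hpt := hp_one t ht
    rw [hg, ENNReal.mul_rpow_of_nonneg _ _ (by linarith),
      ENNReal.ofReal_rpow_of_pos (Real.rpow_pos_of_pos ht.1 _), ← Real.rpow_mul ht.1.le,
      inv_mul_cancel₀ (by linarith), Real.rpow_one]
  have hgmod : ∫⁻ t in Ioo 0 1, ENNReal.ofReal t⁻¹ * g t ^ p t ≤ 1 := by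
    refine le_trans (le_of_eq ?_) hmod
    refine setLIntegral_congr_fun measurableSet_Ioo fun t ht => ?_
    have ht0 := ht.1
    rw [hgp t ht, ← mul_assoc, ← ENNReal.ofReal_mul (by positivity), inv_mul_cancel₀ ht0.ne',
      ENNReal.ofReal_one, one_mul]
  have hpt : ∀ x ∈ Ioo (0 : ℝ) 1, (ENNReal.ofReal x⁻¹ * hardyOp F x) ^ p x ≤
      K₂ * (ENNReal.ofReal x⁻¹ * ∫⁻ t in Ioo 0 x, ENNReal.ofReal ((t / x) ^ ε) * F t ^ p t) := by
    intro x hx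
    have hx0 := hx.1
    have hpx := hp_one x hx
    have hH : ENNReal.ofReal (x ^ (-invConj p x)) * hardyOp F x ≤
        ENNReal.ofReal (max 1 C) * ∫⁻ t in Ioo 0 x, ENNReal.ofReal ((t / x) ^ ε / t) * g t := by
      rw [hardyOp, ← lintegral_const_mul' _ _ ENNReal.ofReal_ne_top,
        ← lintegral_const_mul' _ _ ENNReal.ofReal_ne_top]
      refine setLIntegral_mono' measurableSet_Ioo fun t ht => ?_
      have ht1 : t ∈ Ioo (0 : ℝ) 1 := ⟨ht.1, ht.2.trans hx.2⟩
      have ht0 := ht.1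
      rw [hg, ← mul_assoc, ← mul_assoc, ← ENNReal.ofReal_mul (by positivity),
        ← ENNReal.ofReal_mul (by positivity)]
      gcongr
      have e : t ^ (-invConj p t) = t ^ (p t)⁻¹ / t := by
        rw [invConj_eq (hp_one t ht1), ← Real.rpow_sub_one ht0.ne']
        congr 1; ring
      calc x ^ (-invConj p x) ≤ C * t ^ (-invConj p t) * (t / x) ^ ε := h t ht1 x hx ht.2.le
        _ ≤ max 1 C * t ^ (-invConj p t) * (t / x) ^ ε := by gcongr; exact le_max_right _ _
        _ = _ := by rw [e]; ring
    -- `x⁻¹ = x ^ (-1 / p x) * x ^ (-1 / p' x)`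
    have e1 : ENNReal.ofReal x⁻¹ * hardyOp F x = ENNReal.ofReal (x⁻¹ ^ (p x)⁻¹) *
        (ENNReal.ofReal (x ^ (-invConj p x)) * hardyOp F x) := by
      rw [← mul_assoc, ← ENNReal.ofReal_mul (by positivity), Real.inv_rpow hx0.le,
        ← Real.rpow_neg hx0.le, ← Real.rpow_add hx0, invConj_eq hpx,
        show -(p x)⁻¹ + -(1 - 1 / p x) = -1 by ring, Real.rpow_neg_one]
    have e2 : ∫⁻ t in Ioo 0 x, ENNReal.ofReal ((t / x) ^ ε / t) * g t ^ p t =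
        ∫⁻ t in Ioo 0 x, ENNReal.ofReal ((t / x) ^ ε) * F t ^ p t := by
      refine setLIntegral_congr_fun measurableSet_Ioo fun t ht => ?_
      have ht0 := ht.1
      rw [hgp t ⟨ht.1, ht.2.trans hx.2⟩, ← mul_assoc, ← ENNReal.ofReal_mul (by positivity),
        div_mul_cancel₀ _ ht0.ne']
    rw [e1, ENNReal.mul_rpow_of_nonneg _ _ (by linarith),
      ENNReal.ofReal_rpow_of_pos (by positivity), ← Real.rpow_mul (by positivity),
      inv_mul_cancel₀ (by linarith), Real.rpow_one, mul_left_comm]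
    gcongr
    calc (ENNReal.ofReal (x ^ (-invConj p x)) * hardyOp F x) ^ p x
        ≤ ENNReal.ofReal (max 1 C) ^ p x *
            (∫⁻ t in Ioo 0 x, ENNReal.ofReal ((t / x) ^ ε / t) * g t) ^ p x := by
          rw [← ENNReal.mul_rpow_of_nonneg _ _ (by linarith)]
          exact ENNReal.rpow_le_rpow hH (by linarith)
      _ ≤ ENNReal.ofReal (max 1 C ^ P) *
            (K₁ * ∫⁻ t in Ioo 0 x, ENNReal.ofReal ((t / x) ^ ε / t) * g t ^ p t) := by
          gcongr ?_ * ?_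
          · rw [ENNReal.ofReal_rpow_of_pos (by positivity)]
            refine ENNReal.ofReal_le_ofReal ?_
            exact Real.rpow_le_rpow_of_exponent_le (le_max_left _ _) (hP x hx)
          · exact rpow_lintegral_kernel_le hp_one hp_mono hP hε hgm hgmod hx
      _ = _ := by rw [e2, hK₂, mul_assoc (ENNReal.ofReal _)]
  calc varModular p (Ioo 0 1) (fun x => ENNReal.ofReal x⁻¹ * hardyOp F x)
      ≤ ∫⁻ x in Ioo 0 1, K₂ * (ENNReal.ofReal x⁻¹ *
          ∫⁻ t in Ioo 0 x, ENNReal.ofReal ((t / x) ^ ε) * F t ^ p t) :=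
        setLIntegral_mono' measurableSet_Ioo hpt
    _ = K₂ * ∫⁻ x in Ioo 0 1, ENNReal.ofReal x⁻¹ *
          ∫⁻ t in Ioo 0 x, ENNReal.ofReal ((t / x) ^ ε) * F t ^ p t :=
        lintegral_const_mul' _ _ hK₂t
    _ ≤ K₂ * (ENNReal.ofReal (1 / ε) * 1) := by
        gcongr
        refine (lintegral_lintegral_kernel_le (hF.pow hpm) hε).trans ?_
        gcongr
        exact hmod
    _ = _ := by rw [mul_one]

/-- By homogeneity, the modular inequality on the unit ball gives the norm inequality. -/
theorem varNorm_hardy_le {p : ℝ → ℝ} (hp_one : ∀ x ∈ Ioo (0 : ℝ) 1, 1 ≤ p x) {K : ℝ≥0∞}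
    (hK1 : 1 ≤ K) (hK : K ≠ ∞)
    (hmod : ∀ F : ℝ → ℝ≥0∞, AEMeasurable F (volume.restrict (Ioo 0 1)) →
      varModular p (Ioo 0 1) F ≤ 1 →
        varModular p (Ioo 0 1) (fun x => ENNReal.ofReal x⁻¹ * hardyOp F x) ≤ K)
    {F : ℝ → ℝ≥0∞} (hF : AEMeasurable F (volume.restrict (Ioo 0 1))) :
    varNorm p (Ioo 0 1) (fun x => ENNReal.ofReal x⁻¹ * hardyOp F x) ≤
      K * varNorm p (Ioo 0 1) F := by
  have hK0 : K ≠ 0 := (zero_lt_one.trans_le hK1).ne'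
  rw [mul_comm, ← ENNReal.div_le_iff hK0 hK]
  refine le_sInf fun l ⟨hl0, hl, h⟩ => ?_
  rw [ENNReal.div_le_iff hK0 hK, mul_comm]
  refine varNorm_le_mul_of_varModular_le measurableSet_Ioo hp_one hK1 hK hl0 hl ?_
  convert hmod (fun x => F x / l) (hF.div_const l) h using 3 with x
  simp only [hardyOp, div_eq_mul_inv]
  rw [lintegral_mul_const' _ _ (ENNReal.inv_ne_top.2 hl0.ne'), mul_assoc]

theorem theorem2p2 (p : ℝ → ℝ)
    (hp_one : ∀ x ∈ Ioo (0 : ℝ) 1, 1 ≤ p x)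
    (hp_mono : MonotoneOn p (Ioo 0 1))
    (hp_bdd : BddAbove (p '' Ioo 0 1)) :
    List.TFAE [
      ∃ C : ℝ, 0 < C ∧ ∀ f : ℝ → ℝ,
        AEMeasurable f (volume.restrict (Ioo 0 1)) → (∀ x ∈ Ioo (0 : ℝ) 1, 0 ≤ f x) →
          varNorm p (Ioo 0 1)
              (fun x => ENNReal.ofReal x⁻¹ * hardyOp (fun t => ENNReal.ofReal (f t)) x)
            ≤ ENNReal.ofReal C * varNorm p (Ioo 0 1) (fun x => ENNReal.ofReal (f x)),
      ∃ C : ℝ, 0 < C ∧ ∀ a ∈ Ioo (0 : ℝ) 1,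
        ∫⁻ x in Ioo a 1, ENNReal.ofReal (x ^ (-invConj p x) / x)
          ≤ ENNReal.ofReal (C * a ^ (-invConj p a)),
      ∃ ε : ℝ, 0 < ε ∧ AlmostDecreasingOn (fun x => x ^ (-invConj p x + ε)) (Ioo 0 1),
      ∃ C : ℝ, 0 < C ∧ ∀ a ∈ Ioo (0 : ℝ) 1,
        ∫⁻ x in Ioo a 1,
            ENNReal.ofReal ((a ^ invConj p a * x ^ (-invConj p x)) ^ p x / x)
          ≤ ENNReal.ofReal C,
      ∃ C : ℝ, 0 < C ∧ ∀ a ∈ Ioo (0 : ℝ) 1,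
        varNorm p (Ioo a 1) (fun x => ENNReal.ofReal x⁻¹)
          ≤ ENNReal.ofReal (C * a ^ (-invConj p a))] := by
  obtain ⟨P, hP'⟩ := hp_bdd
  have hP : ∀ x ∈ Ioo (0 : ℝ) 1, p x ≤ P := fun x hx => hP' (mem_image_of_mem p hx)
  tfae_have 1 → 5 := fun ⟨C, hC, h⟩ =>
    ⟨C + 1, by positivity, fun a ha => varNorm_inv_le_of_hardy hp_one hp_mono hC h ha⟩
  tfae_have 5 → 4 := fun ⟨C, hC, h⟩ =>
    ⟨(C + 1) ^ P, by positivity, fun a ha =>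
      lintegral_le_of_varNorm_inv_le hp_one hP hC ha (h a ha)⟩
  tfae_have 4 → 5 := fun ⟨C, _, h⟩ =>
    ⟨max C 1, by positivity, fun a ha => varNorm_inv_le_of_lintegral_le hp_one h ha⟩
  tfae_have 4 → 3 := fun ⟨C, hC, h⟩ =>
    exists_almostDecreasingOn_of_lintegral_rpow_le hp_one hp_mono hP hC h
  tfae_have 3 → 4 := by
    rintro ⟨ε, hε, h⟩
    obtain ⟨C, _, h⟩ := almostDecreasingOn_rpow_iff.1 h
    exact ⟨max C 1 ^ P / ε, by positivity, fun a ha =>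
      lintegral_rpow_div_le_of_almostDecreasing hp_one hP hε h ha⟩
  tfae_have 3 → 2 := by
    rintro ⟨ε, hε, h⟩
    obtain ⟨C, hC, h⟩ := almostDecreasingOn_rpow_iff.1 h
    exact ⟨C / ε, by positivity, fun a ha =>
      lintegral_rpow_neg_div_le_of_almostDecreasing hε hC h ha⟩
  tfae_have 2 → 3 := fun ⟨C, hC, h⟩ =>
    exists_almostDecreasingOn_of_lintegral_le (fun x _ => invConj_nonneg p x)
      (fun x hx => invConj_le_one (hp_one x hx)) (monotoneOn_invConj hp_one hp_mono)
      one_pos hC (by simpa only [Real.rpow_one] using h)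
  tfae_have 3 → 1 := by
    rintro ⟨ε, hε, h⟩
    obtain ⟨C, _, h⟩ := almostDecreasingOn_rpow_iff.1 h
    obtain ⟨K, hK1, hK, hmod⟩ := exists_varModular_hardy_le hp_one hp_mono hP hε h
    refine ⟨K.toReal, ENNReal.toReal_pos (zero_lt_one.trans_le hK1).ne' hK, fun f hf _ => ?_⟩
    rw [ENNReal.ofReal_toReal hK]
    exact varNorm_hardy_le hp_one hK1 hK hmod hf.ennreal_ofReal
  tfae_finish
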